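/- Let $\mathbb D$ be the open unit disk in $\mathbb C$. A weight on $\mathbb D$ is a bounded, continuous, strictly positive function $\mu:\mathbb D\to(0,\infty)$. For a holomorphic function $f$ on $\mathbb D$ put $\|f\|_\mu=\sup_{z\in\mathbb D}\mu(z)|f'(z)|$. The $\mu$-Bloch space $\mathcal B^\mu$ is the space of all holomorphic $f$ on $\mathbb D$ with $\|f\|_\mu<\infty$, normed by $\|f\|_{\mathcal B^\mu}=|f(0)|+\|f\|_\mu$. The log-Bloch space $\mathcal B^{\log}$ is $\mathcal B^{v_{\log}}$ for the weight $v_{\log}(z)=(1-|z|)\log\frac{3}{1-|z|}$, and $\|\cdot\|_{\log}=\|\cdot\|_{v_{\log}}$. Let $F_j(z)=z^j$. Let $\mu$ be a weight on $\mathbb D$ and let $\varphi:\mathbb D\to\mathbb D$ be holomorphic; $\varphi^j$ denotes the $j$-th pointwise power of $\varphi$. Say that $C_\varphi:\mathcal B^{\log}\to\mathcal B^\mu$ is compact if $f\circ\varphi\in\mathcal B^\mu$ for all $f\in\mathcal B^{\log}$ and the linear operator $C_\varphi f=f\circ\varphi$ from $\mathcal B^{\log}$ to $\mathcal B^\mu$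 is compact. Then the following are equivalent: (i) $C_\varphi:\mathcal B^{\log}\to\mathcal B^\mu$ is compact; (ii) $\|\varphi^j\|_\mu<\infty$ for all $j\ge 1$, and $\displaystyle\lim_{j\to\infty}\frac{\|\varphi^j\|_\mu}{\log(j+1)}=0$; (iii) $\|\varphi^j\|_\mu<\infty$ for all $j\ge 1$, and $\displaystyle\lim_{j\to\infty}\frac{\|\varphi^j\|_\mu}{\|F_j\|_{\log}}=0$. -/

import Mathlib

open Filter
open scoped Topology Complex.UnitDisc

noncomputable section

namespace LogBloch

/-- Extension by zero of a function on the open unit disc to the whole plane. It is only used to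
speak of complex differentiability and of the derivative at points of the (open) disc. -/
def extend (f : 𝔻 → ℂ) (z : ℂ) : ℂ :=
  if hz : ‖z‖ < 1 then f (Complex.UnitDisc.mk z hz) else 0

/-- `f` is holomorphic on the open unit disc. -/
def IsHolomorphic (f : 𝔻 → ℂ) : Prop :=
  DifferentiableOn ℂ (extend f) (Metric.ball 0 1)

/-- The complex derivative `f'(z)` at a point `z` of the disc. -/
def derivative (f : 𝔻 → ℂ) (z : 𝔻) : ℂ :=
  deriv (extend f) (z : ℂ)

/-- A weight on the disc: a bounded, continuous and strictly positive function. -/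
structure Weight where
  /-- the underlying function -/
  toFun : 𝔻 → ℝ
  continuous : Continuous toFun
  pos : ∀ z, 0 < toFun z
  bounded : ∃ C, ∀ z, toFun z ≤ C

instance : CoeFun Weight (fun _ => 𝔻 → ℝ) := ⟨Weight.toFun⟩

/-- The semi-norm `‖f‖_μ = sup_{z ∈ 𝔻} μ(z) |f'(z)|`, meaningful if the supremum is finite. -/
def seminorm (μ : Weight) (f : 𝔻 → ℂ) : ℝ :=
  ⨆ z : 𝔻, μ z * ‖derivative f z‖

/-- `f` belongs to the `μ`-Bloch space: it is holomorphic on the disc and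
`sup_{z ∈ 𝔻} μ(z) |f'(z)| < ∞`. -/
def MemBloch (μ : Weight) (f : 𝔻 → ℂ) : Prop :=
  IsHolomorphic f ∧ BddAbove (Set.range fun z : 𝔻 => μ z * ‖derivative f z‖)

theorem extend_add (f g : 𝔻 → ℂ) : extend (f + g) = extend f + extend g := by
  funext z
  by_cases hz : ‖z‖ < 1 <;> simp [extend, hz]

theorem extend_smul (c : ℂ) (f : 𝔻 → ℂ) : extend (c • f) = c • extend f := by
  funext z
  by_cases hz : ‖z‖ < 1 <;> simp [extend, hz]

theorem extend_coe (f : 𝔻 → ℂ) (z : 𝔻) : extend f (z : ℂ) = f z := by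
  simp [extend, z.norm_lt_one]

theorem IsHolomorphic.differentiableAt {f : 𝔻 → ℂ} (hf : IsHolomorphic f) (z : 𝔻) :
    DifferentiableAt ℂ (extend f) (z : ℂ) :=
  DifferentiableOn.differentiableAt hf
    (Metric.isOpen_ball.mem_nhds (mem_ball_zero_iff.2 z.norm_lt_one))

theorem derivative_add {f g : 𝔻 → ℂ} (hf : IsHolomorphic f) (hg : IsHolomorphic g) (z : 𝔻) :
    derivative (f + g) z = derivative f z + derivative g z := by
  rw [derivative, extend_add]
  exact deriv_add (hf.differentiableAt z) (hg.differentiableAt z)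

theorem derivative_smul {f : 𝔻 → ℂ} (hf : IsHolomorphic f) (c : ℂ) (z : 𝔻) :
    derivative (c • f) z = c * derivative f z := by
  rw [derivative, extend_smul]
  exact deriv_const_smul c (hf.differentiableAt z)

theorem MemBloch.le_seminorm {μ : Weight} {f : 𝔻 → ℂ} (hf : MemBloch μ f) (z : 𝔻) :
    μ z * ‖derivative f z‖ ≤ seminorm μ f :=
  le_ciSup hf.2 z

theorem seminorm_nonneg (μ : Weight) (f : 𝔻 → ℂ) : 0 ≤ seminorm μ f :=
  Real.iSup_nonneg fun z => mul_nonneg (μ.pos z).le (norm_nonneg _)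

theorem MemBloch.add_le {μ : Weight} {f g : 𝔻 → ℂ} (hf : MemBloch μ f) (hg : MemBloch μ g)
    (z : 𝔻) : μ z * ‖derivative (f + g) z‖ ≤ seminorm μ f + seminorm μ g := by
  rw [derivative_add hf.1 hg.1]
  have h := mul_le_mul_of_nonneg_left (norm_add_le (derivative f z) (derivative g z)) (μ.pos z).le
  have h1 := hf.le_seminorm z
  have h2 := hg.le_seminorm z
  linarith

theorem MemBloch.add {μ : Weight} {f g : 𝔻 → ℂ} (hf : MemBloch μ f) (hg : MemBloch μ g) :
    MemBloch μ (f + g) := by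
  refine ⟨?_, seminorm μ f + seminorm μ g, ?_⟩
  · rw [IsHolomorphic, extend_add]
    exact DifferentiableOn.add hf.1 hg.1
  · rintro _ ⟨z, rfl⟩
    exact hf.add_le hg z

theorem MemBloch.smul {μ : Weight} {f : 𝔻 → ℂ} (c : ℂ) (hf : MemBloch μ f) :
    MemBloch μ (c • f) := by
  refine ⟨?_, ‖c‖ * seminorm μ f, ?_⟩
  · rw [IsHolomorphic, extend_smul]
    exact DifferentiableOn.const_smul hf.1 c
  · rintro _ ⟨z, rfl⟩
    have h := mul_le_mul_of_nonneg_left (hf.le_seminorm z) (norm_nonneg c)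
    simp only [derivative_smul hf.1, norm_mul]
    linarith

theorem MemBloch.zero (μ : Weight) : MemBloch μ (0 : 𝔻 → ℂ) := by
  have h : extend (0 : 𝔻 → ℂ) = fun _ => 0 := by
    funext z
    by_cases hz : ‖z‖ < 1 <;> simp [extend, hz]
  refine ⟨?_, 0, ?_⟩
  · rw [IsHolomorphic, h]
    exact differentiableOn_const 0
  · rintro _ ⟨z, rfl⟩
    simp [derivative, h]

/-- The `μ`-Bloch space as a linear subspace of the space of all functions on the disc. -/
def blochSubmodule (μ : Weight) : Submodule ℂ (𝔻 → ℂ) where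
  carrier := {f | MemBloch μ f}
  add_mem' := fun hf hg => MemBloch.add hf hg
  zero_mem' := MemBloch.zero μ
  smul_mem' := fun c _ hf => MemBloch.smul c hf

/-- The `μ`-Bloch space, as a type of its own: its topology is the one given by the norm
below, not that of pointwise convergence. -/
def Bloch (μ : Weight) : Type := blochSubmodule μ

instance (μ : Weight) : AddCommGroup (Bloch μ) := inferInstanceAs (AddCommGroup (blochSubmodule μ))

instance (μ : Weight) : Module ℂ (Bloch μ) := inferInstanceAs (Module ℂ (blochSubmodule μ))

/-- The norm `‖f‖_{𝓑^μ} = |f(0)| + ‖f‖_μ`. -/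
instance (μ : Weight) : Norm (Bloch μ) := ⟨fun f => ‖f.1 0‖ + seminorm μ f.1⟩

theorem norm_def {μ : Weight} (f : Bloch μ) : ‖f‖ = ‖f.1 0‖ + seminorm μ f.1 := rfl

theorem seminorm_smul {μ : Weight} {f : 𝔻 → ℂ} (c : ℂ) (hf : MemBloch μ f) :
    seminorm μ (c • f) = ‖c‖ * seminorm μ f := by
  rw [seminorm, seminorm, Real.mul_iSup_of_nonneg (norm_nonneg c)]
  refine iSup_congr fun z => ?_
  rw [derivative_smul hf.1, norm_mul]
  ring

theorem eq_zero_of_seminorm_eq_zero {μ : Weight} {f : 𝔻 → ℂ} (hf : MemBloch μ f)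
    (h0 : f 0 = 0) (h : seminorm μ f = 0) : f = 0 := by
  have hd : (Metric.ball (0 : ℂ) 1).EqOn (deriv (extend f)) 0 := by
    intro w hw
    have h1 := hf.le_seminorm (Complex.UnitDisc.mk w (mem_ball_zero_iff.1 hw))
    rw [h] at h1
    have h2 := nonpos_of_mul_nonpos_right h1 (μ.pos _)
    exact norm_le_zero_iff.1 h2
  funext z
  have hz := Metric.isOpen_ball.is_const_of_deriv_eq_zero
    (convex_ball (0 : ℂ) 1).isPreconnected hf.1 hd
    (mem_ball_zero_iff.2 z.norm_lt_one) (mem_ball_zero_iff.2 (0 : 𝔻).norm_lt_one)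
  rw [extend_coe, extend_coe, h0] at hz
  exact hz

theorem bloch_core (μ : Weight) : NormedSpace.Core ℂ (Bloch μ) where
  norm_nonneg f := add_nonneg (norm_nonneg _) (seminorm_nonneg μ _)
  norm_smul c f := by
    have h : (c • f).1 = c • f.1 := rfl
    rw [norm_def, norm_def, h, seminorm_smul c f.2, Pi.smul_apply, norm_smul]
    ring
  norm_triangle f g := by
    have h : (f + g).1 = f.1 + g.1 := rfl
    have h1 : seminorm μ (f.1 + g.1) ≤ seminorm μ f.1 + seminorm μ g.1 :=
      ciSup_le fun z => MemBloch.add_le f.2 g.2 z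
    have h2 := norm_add_le (f.1 0) (g.1 0)
    rw [norm_def, norm_def, norm_def, h, Pi.add_apply]
    linarith
  norm_eq_zero_iff f := by
    constructor
    · intro h
      rw [norm_def] at h
      have h1 := norm_nonneg (f.1 0)
      have h2 := seminorm_nonneg μ f.1
      exact Subtype.ext (eq_zero_of_seminorm_eq_zero f.2
        (norm_eq_zero.1 (by linarith)) (by linarith))
    · rintro rfl
      have h := seminorm_smul (0 : ℂ) (MemBloch.zero μ)
      have h0 : (0 : Bloch μ).1 = (0 : 𝔻 → ℂ) := rfl
      rw [norm_def, h0]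
      simpa using h

instance (μ : Weight) : NormedAddCommGroup (Bloch μ) := NormedAddCommGroup.ofCore (bloch_core μ)

instance (μ : Weight) : NormedSpace ℂ (Bloch μ) := NormedSpace.ofCore (bloch_core μ)

/-- The composition operator `C_φ f = f ∘ φ` from `𝓑^ν` to `𝓑^μ`, for a self-map `φ` of the
disc such that `f ∘ φ ∈ 𝓑^μ` for all `f ∈ 𝓑^ν`. -/
def compOp (ν μ : Weight) (φ : 𝔻 → 𝔻) (h : ∀ f, MemBloch ν f → MemBloch μ (f ∘ φ)) :
    Bloch ν →ₗ[ℂ] Bloch μ where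
  toFun f := ⟨f.1 ∘ φ, h f.1 f.2⟩
  map_add' _ _ := rfl
  map_smul' _ _ := rfl

/-- `C_φ : 𝓑^ν → 𝓑^μ` is a compact operator: composition with `φ` maps `𝓑^ν` into `𝓑^μ`, and
the resulting linear operator is compact. -/
def IsCompactCompOp (ν μ : Weight) (φ : 𝔻 → 𝔻) : Prop :=
  ∃ h : ∀ f, MemBloch ν f → MemBloch μ (f ∘ φ), IsCompactOperator (compOp ν μ φ h)

/-- The weight `v_log(z) = (1 - |z|) log (3 / (1 - |z|))`. -/
def vlog : Weight where
  toFun z := (1 - ‖(z : ℂ)‖) * Real.log (3 / (1 - ‖(z : ℂ)‖))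
  continuous := by
    have h : Continuous fun z : 𝔻 => 1 - ‖(z : ℂ)‖ :=
      continuous_const.sub Complex.UnitDisc.continuous_coe.norm
    have hne : ∀ z : 𝔻, 1 - ‖(z : ℂ)‖ ≠ 0 := fun z => (sub_pos.2 z.norm_lt_one).ne'
    exact h.mul ((continuous_const.div h hne).log fun z => div_ne_zero three_ne_zero (hne z))
  pos z := by
    have h := sub_pos.2 z.norm_lt_one
    have h0 := norm_nonneg (z : ℂ)
    refine mul_pos h (Real.log_pos ?_)
    rw [lt_div_iff₀ h]
    linarith
  bounded := by
    refine ⟨3, fun z => ?_⟩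
    have h := sub_pos.2 z.norm_lt_one
    have h1 := Real.log_le_self (div_pos three_pos h).le
    calc (1 - ‖(z : ℂ)‖) * Real.log (3 / (1 - ‖(z : ℂ)‖))
        ≤ (1 - ‖(z : ℂ)‖) * (3 / (1 - ‖(z : ℂ)‖)) := mul_le_mul_of_nonneg_left h1 h.le
      _ = 3 := mul_div_cancel₀ 3 h.ne'

/-- The monomial `F_j(z) = z^j` on the disc. -/
def monomial (j : ℕ) (z : 𝔻) : ℂ := (z : ℂ) ^ j

/-- The power `φ^j` (pointwise, not iterated) of a self-map `φ` of the disc. -/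
def power (φ : 𝔻 → 𝔻) (j : ℕ) (z : 𝔻) : ℂ := (φ z : ℂ) ^ j

end LogBloch

end

namespace LogBloch

/-! The norms `‖F_j‖_log` lie between `1/4` and `6 log (j + 1)`. The upper bound turns decay
relative to `‖F_j‖_log` into decay relative to `log (j + 1)`, so it suffices to prove (i) ⇒ (iii)
and (ii) ⇒ (i).

For (i) ⇒ (iii), the images of `F_j / ‖F_j‖_log` lie in a compact set and tend to zero pointwise
with their derivatives, hence in norm (`Bloch.tendsto_zero_of_pointwise`).

For (ii) ⇒ (i), let `t = 1 - |φ z|` be small and test with `j` about `1 / (2t)`. Then `j |φ z|^(j-1)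
≥ 1 / (4t)`, so decay of `‖φ^j‖_μ` gives `μ |φ'| ≤ ε v_log(φ)` at `z`
(`exists_radius_weight_mul_derivative_le`). This controls `C_φ f` where `|φ|` is near 1. Elsewhere a
Montel argument (`exists_tendstoLocallyUniformlyOn_extend`) gives uniform convergence of `f'` on a
smaller disc, while `μ |φ'|` is bounded. -/

theorem vlog_apply (z : 𝔻) :
    vlog z = (1 - ‖(z : ℂ)‖) * Real.log (3 / (1 - ‖(z : ℂ)‖)) := rfl

/-- The logarithmic factor is at least `log 3 > 1`, because `e < 3`. -/
theorem one_sub_norm_le_vlog (z : 𝔻) : 1 - ‖(z : ℂ)‖ ≤ vlog z := by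
  have h := sub_pos.2 z.norm_lt_one
  have h0 := norm_nonneg (z : ℂ)
  rw [vlog_apply]
  refine le_mul_of_one_le_right h.le ?_
  rw [Real.le_log_iff_exp_le (by positivity), le_div_iff₀ h]
  have := Real.exp_one_lt_d9
  nlinarith [Real.exp_pos 1]

/-! ### Chain rule on the disc, monomials and powers. -/

/-- The restriction to the disc matters: outside it the left side is `0` and the right side is `f
0`. -/
theorem extend_eqOn_comp (f : 𝔻 → ℂ) (φ : 𝔻 → 𝔻) :
    (Metric.ball (0 : ℂ) 1).EqOn (extend (f ∘ φ)) (extend f ∘ extend fun z => (φ z : ℂ)) := by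
  intro w hw
  have hw' : ‖w‖ < 1 := mem_ball_zero_iff.1 hw
  have h1 : extend (fun z => (φ z : ℂ)) w = (φ (Complex.UnitDisc.mk w hw') : ℂ) := by
    simp [extend, hw']
  rw [Function.comp_apply, h1, extend_coe]
  simp [extend, hw']

theorem mapsTo_extend_ball (φ : 𝔻 → 𝔻) :
    Set.MapsTo (extend fun z => (φ z : ℂ)) (Metric.ball 0 1) (Metric.ball 0 1) := by
  intro w hw
  have hw' : ‖w‖ < 1 := mem_ball_zero_iff.1 hw
  simpa [extend, hw'] using (φ (Complex.UnitDisc.mk w hw')).norm_lt_one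

theorem IsHolomorphic.comp {f : 𝔻 → ℂ} {φ : 𝔻 → 𝔻} (hf : IsHolomorphic f)
    (hφ : IsHolomorphic fun z => (φ z : ℂ)) : IsHolomorphic (f ∘ φ) :=
  (DifferentiableOn.comp hf hφ (mapsTo_extend_ball φ)).congr (extend_eqOn_comp f φ)

theorem coe_mem_ball (z : 𝔻) : (z : ℂ) ∈ Metric.ball (0 : ℂ) 1 :=
  mem_ball_zero_iff.2 z.norm_lt_one

theorem ball_mem_nhds_coe (z : 𝔻) : Metric.ball (0 : ℂ) 1 ∈ 𝓝 (z : ℂ) :=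
  Metric.isOpen_ball.mem_nhds (coe_mem_ball z)

theorem derivative_comp {f : 𝔻 → ℂ} {φ : 𝔻 → 𝔻} (hf : IsHolomorphic f)
    (hφ : IsHolomorphic fun z => (φ z : ℂ)) (z : 𝔻) :
    derivative (f ∘ φ) z = derivative f (φ z) * derivative (fun z => (φ z : ℂ)) z := by
  have h1 : extend (fun z => (φ z : ℂ)) (z : ℂ) = (φ z : ℂ) := extend_coe _ z
  rw [derivative, (extend_eqOn_comp f φ).eventuallyEq_of_mem (ball_mem_nhds_coe z) |>.deriv_eq,
    deriv_comp _ (by rw [h1]; exact hf.differentiableAt (φ z)) (hφ.differentiableAt z), h1]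
  rfl

theorem extend_monomial_eqOn (j : ℕ) :
    (Metric.ball (0 : ℂ) 1).EqOn (extend (monomial j)) fun w => w ^ j := by
  intro w hw
  have hw' : ‖w‖ < 1 := mem_ball_zero_iff.1 hw
  simp [extend, hw', monomial]

theorem isHolomorphic_monomial (j : ℕ) : IsHolomorphic (monomial j) :=
  (differentiable_pow j).differentiableOn.congr (extend_monomial_eqOn j)

theorem derivative_monomial (j : ℕ) (z : 𝔻) :
    derivative (monomial j) z = j * (z : ℂ) ^ (j - 1) := by
  rw [derivative, (extend_monomial_eqOn j).eventuallyEq_of_mem (ball_mem_nhds_coe z) |>.deriv_eq]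
  simp

theorem power_eq_comp (φ : 𝔻 → 𝔻) (j : ℕ) : power φ j = monomial j ∘ φ := rfl

theorem norm_derivative_power {φ : 𝔻 → 𝔻} (hφ : IsHolomorphic fun z => (φ z : ℂ)) (j : ℕ)
    (z : 𝔻) : ‖derivative (power φ j) z‖ =
      j * ‖(φ z : ℂ)‖ ^ (j - 1) * ‖derivative (fun z => (φ z : ℂ)) z‖ := by
  rw [power_eq_comp, derivative_comp (isHolomorphic_monomial j) hφ, derivative_monomial]
  simp

/-! ### Size of the monomials in the log-Bloch seminorm. -/

/-- Bernoulli-type bound on a single binomial probability. -/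
theorem mul_one_sub_pow_le_one {j : ℕ} (hj : 1 ≤ j) {t : ℝ} (h0 : 0 ≤ t) (h1 : t ≤ 1) :
    j * t * (1 - t) ^ (j - 1) ≤ 1 := by
  obtain ⟨n, rfl⟩ := Nat.exists_eq_add_of_le' hj
  have hb := one_add_mul_le_pow (by linarith : (-2 : ℝ) ≤ t) n
  have hs : (1 - t) ^ n * (1 + t) ^ n ≤ 1 := by
    rw [← mul_pow]
    exact pow_le_one₀ (by nlinarith) (by nlinarith)
  have hp : 0 ≤ (1 - t) ^ n := pow_nonneg (by linarith) n
  simp only [Nat.add_sub_cancel]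
  push_cast
  -- `t ≤ 1` gives the first inequality, Bernoulli the second, and `1 - t ^ 2 ≤ 1` the last.
  calc ((n : ℝ) + 1) * t * (1 - t) ^ n ≤ (1 + n * t) * (1 - t) ^ n := by
        gcongr
        nlinarith
    _ ≤ (1 + t) ^ n * (1 - t) ^ n := by gcongr
    _ ≤ 1 := by linarith

theorem vlog_mul_derivative_monomial_le {j : ℕ} (hj : 1 ≤ j) (z : 𝔻) :
    vlog z * ‖derivative (monomial j) z‖ ≤ 6 * Real.log ((j : ℝ) + 1) := by
  have hj' : (1 : ℝ) ≤ j := by exact_mod_cast hj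
  have ht := sub_pos.2 z.norm_lt_one
  have hr := norm_nonneg (z : ℂ)
  rw [derivative_monomial, vlog_apply]
  simp only [norm_mul, norm_pow, Complex.norm_natCast]
  set t := 1 - ‖(z : ℂ)‖ with htdef
  have hz : ‖(z : ℂ)‖ = 1 - t := by rw [htdef]; ring
  rw [hz] at hr ⊢
  have hp0 : 0 ≤ (1 - t) ^ (j - 1) := pow_nonneg hr _
  have hp1 : (1 - t) ^ (j - 1) ≤ 1 := pow_le_one₀ hr (by linarith)
  have hb := mul_one_sub_pow_le_one hj ht.le (by linarith)
  -- Comparing `1 / t` with `j` leaves an error `1 / (j * t)`, which the factor `j * t` cancels.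
  have hl : Real.log (3 / t) ≤ Real.log (3 * j) + 1 / (j * t) := by
    have : 3 / t = (3 * j) * (1 / (j * t)) := by field_simp
    rw [this, Real.log_mul (by positivity) (by positivity)]
    have := Real.log_le_self (by positivity : 0 ≤ 1 / (j * t))
    linarith
  have hl3 : 0 ≤ Real.log (3 * j) := Real.log_nonneg (by linarith)
  have h2 := Real.log_two_gt_d9
  have hlj : Real.log 2 ≤ Real.log (j + 1) := Real.log_le_log (by norm_num) (by linarith)
  have hl3' : Real.log (3 * j) ≤ 2 + Real.log (j + 1) := by
    rw [Real.log_mul (by norm_num) (by positivity)]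
    have := Real.log_le_sub_one_of_pos (by norm_num : (0 : ℝ) < 3)
    have := Real.log_le_log (by linarith : (0 : ℝ) < j) (by linarith : (j : ℝ) ≤ j + 1)
    linarith
  calc t * Real.log (3 / t) * (j * (1 - t) ^ (j - 1))
      = (j * t * (1 - t) ^ (j - 1)) * Real.log (3 / t) := by ring
    _ ≤ (j * t * (1 - t) ^ (j - 1)) * (Real.log (3 * j) + 1 / (j * t)) := by gcongr
    _ = (j * t * (1 - t) ^ (j - 1)) * Real.log (3 * j) + (1 - t) ^ (j - 1) := by
        field_simp
    _ ≤ 1 * Real.log (3 * j) + 1 := by gcongr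
    -- The left side is at most `3 + log (j + 1)`, and `3 ≤ 5 log 2 ≤ 5 log (j + 1)`.
    _ ≤ 6 * Real.log (j + 1) := by linarith

theorem memBloch_vlog_monomial (j : ℕ) : MemBloch vlog (monomial j) := by
  refine ⟨isHolomorphic_monomial j, 6 * Real.log ((j : ℝ) + 1), ?_⟩
  rintro _ ⟨z, rfl⟩
  rcases Nat.eq_zero_or_pos j with rfl | hj
  · simp [derivative_monomial]
  · exact vlog_mul_derivative_monomial_le hj z

theorem seminorm_vlog_monomial_le {j : ℕ} (hj : 1 ≤ j) :
    seminorm vlog (monomial j) ≤ 6 * Real.log ((j : ℝ) + 1) :=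
  ciSup_le (vlog_mul_derivative_monomial_le hj)

/-- Evaluate at radius `1 - 1 / (2j)`, where Bernoulli keeps the power above `1/2`. No logarithmic
growth is needed: the bound only makes the normalising factors positive and bounded. -/
theorem one_fourth_le_seminorm_vlog_monomial {j : ℕ} (hj : 1 ≤ j) :
    1 / 4 ≤ seminorm vlog (monomial j) := by
  have hj' : (1 : ℝ) ≤ j := by exact_mod_cast hj
  have hs : (1 : ℝ) / (2 * j) ≤ 1 / 2 := by
    rw [div_le_div_iff₀ (by positivity) (by norm_num)]
    linarith
  have hs0 : (0 : ℝ) < 1 / (2 * j) := by positivity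
  have hn : ‖((1 - 1 / (2 * j) : ℝ) : ℂ)‖ = 1 - 1 / (2 * j) := by
    rw [Complex.norm_real, Real.norm_of_nonneg (by linarith)]
  refine le_trans ?_ ((memBloch_vlog_monomial j).le_seminorm
    (Complex.UnitDisc.mk ((1 - 1 / (2 * j) : ℝ) : ℂ) (by rw [hn]; linarith)))
  refine le_trans ?_ (mul_le_mul_of_nonneg_right (one_sub_norm_le_vlog _) (norm_nonneg _))
  rw [derivative_monomial]
  simp only [norm_mul, norm_pow, Complex.norm_natCast, Complex.UnitDisc.coe_mk, hn]
  have hb := one_add_mul_le_pow (by linarith : (-2 : ℝ) ≤ -(1 / (2 * j))) (j - 1)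
  rw [← sub_eq_add_neg, Nat.cast_sub hj] at hb
  have : (1 : ℝ) / 2 ≤ 1 + (j - (1 : ℕ)) * -(1 / (2 * j)) := by
    push_cast
    have : (1 : ℝ) + (j - 1) * -(1 / (2 * j)) = 1 / 2 + 1 / (2 * j) := by field_simp; ring
    linarith
  have h2 : (1 : ℝ) / 2 ≤ (1 - 1 / (2 * j)) ^ (j - 1) := by linarith
  calc (1 : ℝ) / 4 = (1 - (1 - 1 / (2 * (j : ℝ)))) * (j * (1 / 2)) := by field_simp; norm_num
    _ ≤ _ := by gcongr; linarith

/-! ### Continuous functionals on Bloch spaces. -/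

theorem Bloch.norm_derivative_le {μ : Weight} (f : Bloch μ) (z : 𝔻) :
    μ z * ‖derivative f.1 z‖ ≤ ‖f‖ :=
  (MemBloch.le_seminorm f.2 z).trans (le_add_of_nonneg_left (norm_nonneg _))

theorem Bloch.norm_apply_zero_le {μ : Weight} (f : Bloch μ) : ‖f.1 0‖ ≤ ‖f‖ :=
  le_add_of_nonneg_right (seminorm_nonneg μ _)

theorem Bloch.seminorm_le_norm {μ : Weight} (f : Bloch μ) : seminorm μ f.1 ≤ ‖f‖ :=
  le_add_of_nonneg_left (norm_nonneg _)

/-- The derivative at a point, as a continuous linear functional on the Bloch space. -/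
noncomputable def Bloch.derivativeCLM (μ : Weight) (z : 𝔻) : Bloch μ →L[ℂ] ℂ :=
  LinearMap.mkContinuous
    { toFun := fun f => derivative f.1 z
      map_add' := fun f g => derivative_add f.2.1 g.2.1 z
      map_smul' := fun c f => derivative_smul f.2.1 c z } (μ z)⁻¹ fun f => by
    rw [inv_mul_eq_div, le_div_iff₀ (μ.pos z), mul_comm]
    exact f.norm_derivative_le z

/-- Evaluation at the origin, as a continuous linear functional on the Bloch space. -/
noncomputable def Bloch.evalZeroCLM (μ : Weight) : Bloch μ →L[ℂ] ℂ :=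
  LinearMap.mkContinuous
    { toFun := fun f => f.1 0
      map_add' := fun _ _ => rfl
      map_smul' := fun _ _ => rfl } 1 fun f => by
    rw [one_mul]
    exact f.norm_apply_zero_le

/-- A relatively compact family in a Bloch space tends to zero as soon as its values at the origin
and its derivatives tend to zero pointwise. -/
theorem Bloch.tendsto_zero_of_pointwise {ι : Type*} {l : Filter ι} {μ : Weight} {u : ι → Bloch μ}
    {K : Set (Bloch μ)} (hK : IsCompact K) (hu : ∀ i, u i ∈ K)
    (h0 : Tendsto (fun i => (u i).1 0) l (𝓝 0))
    (hd : ∀ z, Tendsto (fun i => derivative (u i).1 z) l (𝓝 0)) : Tendsto u l (𝓝 0) := by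
  -- In a compact set it is enough that `0` is the only cluster point; evaluation at the origin and
  -- the derivatives detect this.
  refine hK.tendsto_nhds_of_unique_mapClusterPt (Eventually.of_forall hu) fun h _ hh => ?_
  have key : ∀ T : Bloch μ →L[ℂ] ℂ, Tendsto (fun i => T (u i)) l (𝓝 0) → T h = 0 := by
    intro T hT
    have hc : MapClusterPt (T h) l (T ∘ u) := hh.tendsto_comp (T.continuous.tendsto h)
    have hne : (𝓝 (T h) ⊓ 𝓝 0).NeBot := hc.neBot.mono (inf_le_inf_left _ hT)
    exact eq_of_nhds_neBot hne
  have h1 : h.1 0 = 0 := key (Bloch.evalZeroCLM μ) h0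
  have h2 : ∀ z, derivative h.1 z = 0 := fun z => key (Bloch.derivativeCLM μ z) (hd z)
  rw [← norm_eq_zero, norm_def, h1]
  simp [seminorm, h2]

/-- The monomial `z ^ j` as an element of the log-Bloch space. -/
noncomputable def blochMonomial (j : ℕ) : Bloch vlog := ⟨monomial j, memBloch_vlog_monomial j⟩

/-! ### Compactness forces decay of the powers. -/

theorem IsCompactCompOp.memBloch_power {μ : Weight} {φ : 𝔻 → 𝔻}
    (h : IsCompactCompOp vlog μ φ) (j : ℕ) : MemBloch μ (power φ j) :=
  h.1 _ (memBloch_vlog_monomial j)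

theorem IsCompactCompOp.tendsto_seminorm_power_div_seminorm_monomial {μ : Weight} {φ : 𝔻 → 𝔻}
    (hφ : IsHolomorphic fun z => (φ z : ℂ)) (hc : IsCompactCompOp vlog μ φ) :
    Tendsto (fun j : ℕ => seminorm μ (power φ j) / seminorm vlog (monomial j)) atTop (𝓝 0) := by
  have hmem := hc.memBloch_power
  obtain ⟨h, hcomp⟩ := hc
  obtain ⟨K, hK, hKs⟩ := hcomp.image_closedBall_subset_compact 1
  -- The shift discards `F_0`, whose seminorm is zero and which cannot be normalised.
  rw [← tendsto_add_atTop_iff_nat 1]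
  set s : ℕ → ℝ := fun j => seminorm vlog (monomial (j + 1)) with hs
  have hs4 : ∀ j, 1 / 4 ≤ s j := fun j => one_fourth_le_seminorm_vlog_monomial (Nat.le_add_left 1 j)
  have hs0 : ∀ j, 0 < s j := fun j => lt_of_lt_of_le (by norm_num) (hs4 j)
  have hinv : ∀ j, (s j)⁻¹ ≤ 4 := fun j => by
    rw [inv_le_comm₀ (hs0 j) (by norm_num)]
    simpa using hs4 j
  have hnorm : ∀ j, ‖(((s j)⁻¹ : ℝ) : ℂ)‖ = (s j)⁻¹ := fun j => by
    rw [Complex.norm_real, Real.norm_of_nonneg (inv_nonneg.2 (hs0 j).le)]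
  let g : ℕ → Bloch vlog := fun j =>
    (((s j)⁻¹ : ℝ) : ℂ) • blochMonomial (j + 1)
  have hg1 : ∀ j, g j ∈ Metric.closedBall (0 : Bloch vlog) 1 := fun j => by
    rw [mem_closedBall_zero_iff, show g j = (((s j)⁻¹ : ℝ) : ℂ) • blochMonomial (j + 1) from rfl,
      norm_smul, hnorm, norm_def]
    change (s j)⁻¹ * (‖monomial (j + 1) 0‖ + s j) ≤ 1
    rw [monomial, Complex.UnitDisc.coe_zero, zero_pow j.succ_ne_zero, norm_zero, zero_add,
      inv_mul_cancel₀ (hs0 j).ne']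
  have hval : ∀ j, (compOp vlog μ φ h (g j)).1 = (((s j)⁻¹ : ℝ) : ℂ) • power φ (j + 1) :=
    fun j => rfl
  have hlim : Tendsto (fun j => compOp vlog μ φ h (g j)) atTop (𝓝 0) := by
    refine Bloch.tendsto_zero_of_pointwise hK (fun j => hKs ⟨g j, hg1 j, rfl⟩) ?_ fun z => ?_
    · have hp : Tendsto (fun j : ℕ => 4 * ‖(φ 0 : ℂ)‖ ^ (j + 1)) atTop (𝓝 0) := by
        simpa using ((tendsto_pow_atTop_nhds_zero_of_lt_one (norm_nonneg _)
          (φ 0).norm_lt_one).comp (tendsto_add_atTop_nat 1)).const_mul 4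
      refine squeeze_zero_norm (fun j => ?_) hp
      rw [hval, Pi.smul_apply, norm_smul, hnorm, power, norm_pow]
      gcongr
      exact hinv j
    · have hp : Tendsto (fun j : ℕ => 4 * (((j : ℝ) * ‖(φ z : ℂ)‖ ^ j + ‖(φ z : ℂ)‖ ^ j) *
          ‖derivative (fun z => (φ z : ℂ)) z‖)) atTop (𝓝 0) := by
        simpa using (((tendsto_self_mul_const_pow_of_lt_one (norm_nonneg _)
          (φ z).norm_lt_one).add (tendsto_pow_atTop_nhds_zero_of_lt_one (norm_nonneg _)
          (φ z).norm_lt_one)).mul_const ‖derivative (fun z => (φ z : ℂ)) z‖).const_mul 4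
      refine squeeze_zero_norm (fun j => ?_) hp
      rw [hval, derivative_smul (hmem _).1, norm_mul, hnorm, norm_derivative_power hφ,
        Nat.add_sub_cancel, Nat.cast_succ, add_one_mul]
      gcongr
      exact hinv j
  refine squeeze_zero (fun j => div_nonneg (seminorm_nonneg _ _) (hs0 j).le) (fun j => ?_)
    (by simpa using hlim.norm)
  have := Bloch.seminorm_le_norm (compOp vlog μ φ h (g j))
  rwa [hval, seminorm_smul _ (hmem _), hnorm, inv_mul_eq_div] at this

theorem tendsto_seminorm_power_div_log {μ : Weight} {φ : 𝔻 → 𝔻}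
    (h : Tendsto (fun j : ℕ => seminorm μ (power φ j) / seminorm vlog (monomial j))
      atTop (𝓝 0)) :
    Tendsto (fun j : ℕ => seminorm μ (power φ j) / Real.log ((j : ℝ) + 1)) atTop (𝓝 0) := by
  have h6 := h.const_mul 6
  rw [mul_zero] at h6
  refine squeeze_zero' (Eventually.of_forall fun j => ?_) ?_ h6
  · exact div_nonneg (seminorm_nonneg _ _) (Real.log_nonneg (by simp))
  · filter_upwards [eventually_ge_atTop 1] with j hj
    have h0 : 0 < seminorm vlog (monomial j) :=
      lt_of_lt_of_le (by norm_num) (one_fourth_le_seminorm_vlog_monomial hj)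
    have hl : 0 < Real.log ((j : ℝ) + 1) :=
      Real.log_pos (by have : (1 : ℝ) ≤ j := by exact_mod_cast hj
                       linarith)
    have := seminorm_vlog_monomial_le hj
    rw [← mul_div_assoc, div_le_div_iff₀ hl h0]
    have := mul_le_mul_of_nonneg_left this (seminorm_nonneg μ (power φ j))
    linarith

/-! ### Normal families in the log-Bloch unit ball. -/

theorem Bloch.norm_deriv_extend_le (f : Bloch vlog) {r : ℝ} (hr : r < 1) {w : ℂ} (hw : ‖w‖ ≤ r) :
    ‖deriv (extend f.1) w‖ ≤ ‖f‖ / (1 - r) := by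
  have hw1 : ‖w‖ < 1 := hw.trans_lt hr
  have h1 := f.norm_derivative_le (Complex.UnitDisc.mk w hw1)
  have h2 := one_sub_norm_le_vlog (Complex.UnitDisc.mk w hw1)
  simp only [derivative, Complex.UnitDisc.coe_mk] at h1 h2
  rw [le_div_iff₀ (sub_pos.2 hr), mul_comm]
  exact (mul_le_mul_of_nonneg_right (by linarith) (norm_nonneg _)).trans h1

theorem Bloch.lipschitzOnWith_extend (f : Bloch vlog) (hf : ‖f‖ ≤ 1) {r : ℝ} (hr : r < 1) :
    LipschitzOnWith (Real.toNNReal (1 / (1 - r))) (extend f.1) (Metric.closedBall 0 r) := by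
  have h0 : 0 < 1 - r := sub_pos.2 hr
  refine (convex_closedBall (0 : ℂ) r).lipschitzOnWith_of_nnnorm_deriv_le (fun w hw => ?_)
    fun w hw => ?_
  · exact IsHolomorphic.differentiableAt f.2.1
      (Complex.UnitDisc.mk w ((mem_closedBall_zero_iff.1 hw).trans_lt hr))
  · rw [← NNReal.coe_le_coe, coe_nnnorm, Real.coe_toNNReal _ (by positivity)]
    refine (f.norm_deriv_extend_le hr (mem_closedBall_zero_iff.1 hw)).trans ?_
    gcongr

theorem exists_closedBall_superset_of_isCompact {K : Set ℂ} (hK : IsCompact K)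
    (hKb : K ⊆ Metric.ball 0 1) : ∃ r, 0 ≤ r ∧ r < 1 ∧ K ⊆ Metric.closedBall 0 r := by
  rcases K.eq_empty_or_nonempty with rfl | hne
  · exact ⟨0, le_rfl, one_pos, Set.empty_subset _⟩
  · obtain ⟨x, hx, hmax⟩ := hK.exists_isMaxOn hne continuous_norm.continuousOn
    exact ⟨‖x‖, norm_nonneg x, mem_ball_zero_iff.1 (hKb hx),
      fun y hy => mem_closedBall_zero_iff.2 (hmax hy)⟩

theorem deriv_extend_eqOn {g : 𝔻 → ℂ} {G : ℂ → ℂ} (h : (Metric.ball (0 : ℂ) 1).EqOn (extend g) G)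
    (z : 𝔻) : derivative g z = deriv G z :=
  (h.eventuallyEq_of_mem (ball_mem_nhds_coe z)).deriv_eq

/-- The closed unit ball of the log-Bloch space is compact for locally uniform convergence. -/
theorem exists_tendstoLocallyUniformlyOn_extend
    (U : Ultrafilter (Metric.closedBall (0 : Bloch vlog) 1)) :
    ∃ g : Bloch vlog, ‖g‖ ≤ 1 ∧
      TendstoLocallyUniformlyOn (fun i : Metric.closedBall (0 : Bloch vlog) 1 => extend i.1.1)
        (extend g.1) U (Metric.ball 0 1) := by
  set F : Metric.closedBall (0 : Bloch vlog) 1 → ℂ → ℂ := fun i => extend i.1.1 with hF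
  have hi : ∀ i : Metric.closedBall (0 : Bloch vlog) 1, ‖i.1‖ ≤ 1 := fun i =>
    mem_closedBall_zero_iff.1 i.2
  have hbdd : ∀ w : ℂ, ‖w‖ < 1 → ∃ c, Tendsto (fun i => F i w) U (𝓝 c) := by
    intro w hw
    have hmem : ∀ i, F i w ∈ Metric.closedBall (0 : ℂ) (1 + 1 / (1 - ‖w‖) * ‖w‖) := by
      intro i
      have h0 : 0 < 1 - ‖w‖ := sub_pos.2 hw
      have hd := (i.1.lipschitzOnWith_extend (hi i) hw).norm_sub_le
        (mem_closedBall_zero_iff.2 le_rfl) (mem_closedBall_zero_iff.2 (by simp) : (0 : ℂ) ∈ _)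
      rw [Real.coe_toNNReal _ (by positivity), sub_zero] at hd
      have hz : extend i.1.1 0 = i.1.1 0 := by
        simpa using extend_coe i.1.1 0
      have h1 := i.1.norm_apply_zero_le
      rw [mem_closedBall_zero_iff]
      have h2 := norm_le_norm_add_norm_sub' (extend i.1.1 w) (extend i.1.1 0)
      rw [hz] at h2 hd
      have := hi i
      change ‖extend i.1.1 w‖ ≤ _
      linarith
    obtain ⟨c, -, hc⟩ := (isCompact_closedBall (0 : ℂ) _).ultrafilter_le_nhds'
      (U.map fun i => F i w) (Filter.mem_map.2 (Filter.univ_mem' hmem))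
    exact ⟨c, hc⟩
  choose! G hG using hbdd
  -- The Lipschitz constant depends only on the radius, so equicontinuity upgrades pointwise
  -- convergence to uniform convergence on compact sets.
  have hloc : TendstoLocallyUniformlyOn F G U (Metric.ball 0 1) := by
    rw [tendstoLocallyUniformlyOn_iff_forall_isCompact Metric.isOpen_ball]
    intro K hKb hK
    obtain ⟨r, hr0, hr1, hKr⟩ := exists_closedBall_superset_of_isCompact hK hKb
    have heq : ∀ K' ∈ ({K} : Set (Set ℂ)), EquicontinuousOn F K' := by
      rintro _ rfl
      exact (LipschitzOnWith.uniformEquicontinuousOn F _ fun i =>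
        (i.1.lipschitzOnWith_extend (hi i) hr1).mono hKr).equicontinuousOn
    have h := (EquicontinuousOn.tendsto_uniformOnFun_iff_pi' (𝔖 := {K})
      (by rintro _ rfl; exact hK) heq (U : Filter _) G).2 (by
        rw [tendsto_pi_nhds]
        rintro ⟨x, hx⟩
        rw [Set.sUnion_singleton] at hx
        exact hG x (mem_ball_zero_iff.1 (hKb hx)))
    exact UniformOnFun.tendsto_iff_tendstoUniformlyOn.1 h K rfl
  have hFd : ∀ᶠ i in (U : Filter _), DifferentiableOn ℂ (F i) (Metric.ball 0 1) :=
    Eventually.of_forall fun i => i.1.2.1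
  have hGd : DifferentiableOn ℂ G (Metric.ball 0 1) := hloc.differentiableOn hFd Metric.isOpen_ball
  have hder := hloc.deriv hFd Metric.isOpen_ball
  have hgG : (Metric.ball (0 : ℂ) 1).EqOn (extend fun z : 𝔻 => G z) G := by
    intro w hw
    simp [extend, mem_ball_zero_iff.1 hw]
  -- Both terms of the norm pass to the limit together, so the limit stays in the closed unit ball.
  have hbound : ∀ z : 𝔻, ‖G 0‖ + vlog z * ‖derivative (fun z : 𝔻 => G z) z‖ ≤ 1 := by
    intro z
    rw [deriv_extend_eqOn hgG]
    have ht := ((hG 0 (by simp)).norm).add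
      (((hder.tendsto_at (coe_mem_ball z)).norm).const_mul (vlog z))
    refine le_of_tendsto ht (Eventually.of_forall fun i => ?_)
    refine le_trans ?_ (hi i)
    rw [norm_def]
    refine add_le_add (le_of_eq ?_) (MemBloch.le_seminorm i.1.2 z)
    simpa [hF] using congrArg norm (extend_coe i.1.1 0)
  have hmem : MemBloch vlog fun z : 𝔻 => G z := by
    refine ⟨hGd.congr hgG, 1, ?_⟩
    rintro _ ⟨z, rfl⟩
    exact (le_add_of_nonneg_left (norm_nonneg _)).trans (hbound z)
  refine ⟨⟨fun z : 𝔻 => G z, hmem⟩, ?_, hloc.congr_right fun w hw => (hgG hw).symm⟩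
  have hsup : seminorm vlog (fun z : 𝔻 => G z) ≤ 1 - ‖G 0‖ :=
    ciSup_le fun z => by linarith [hbound z]
  change ‖G ((0 : 𝔻) : ℂ)‖ + seminorm vlog (fun z : 𝔻 => G z) ≤ 1
  rw [Complex.UnitDisc.coe_zero]
  linarith

/-! ### Decay of the powers forces compactness. -/

/-- Decay of the powers `φ ^ j` controls `μ |φ'|` by `v_log ∘ φ` near the unit circle. -/
theorem exists_radius_weight_mul_derivative_le {μ : Weight} {φ : 𝔻 → 𝔻}
    (hφ : IsHolomorphic fun z => (φ z : ℂ)) (hmem : ∀ j : ℕ, 1 ≤ j → MemBloch μ (power φ j))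
    (hlim : Tendsto (fun j : ℕ => seminorm μ (power φ j) / Real.log ((j : ℝ) + 1)) atTop (𝓝 0))
    {ε : ℝ} (hε : 0 < ε) :
    ∃ r < 1, ∀ z, r < ‖(φ z : ℂ)‖ →
      μ z * ‖derivative (fun z => (φ z : ℂ)) z‖ ≤ ε * vlog (φ z) := by
  obtain ⟨J, hJ⟩ := eventually_atTop.1
    ((hlim.eventually_lt_const (by positivity : 0 < ε / 4)).and (eventually_ge_atTop 1))
  have hJ1 : (1 : ℝ) ≤ J := by exact_mod_cast (hJ J le_rfl).2
  -- Beyond this radius `1 / (2t) ≥ J`, so the exponent chosen below is in the range where the decay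
  -- holds.
  refine ⟨1 - 1 / (2 * J), sub_lt_self _ (by positivity), fun z hz => ?_⟩
  have ht := sub_pos.2 (φ z).norm_lt_one
  have hr := norm_nonneg (φ z : ℂ)
  rw [vlog_apply]
  set t := 1 - ‖(φ z : ℂ)‖ with htdef
  have hzt : ‖(φ z : ℂ)‖ = 1 - t := by rw [htdef]; ring
  have htJ : t ≤ 1 / (2 * J) := by linarith
  set j := ⌈1 / (2 * t)⌉₊ with hj
  have hj1 : 1 / (2 * t) ≤ j := Nat.le_ceil _
  have hj2 : (j : ℝ) < 1 / (2 * t) + 1 := Nat.ceil_lt_add_one (by positivity)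
  have hJj : J ≤ j := by
    have : (J : ℝ) ≤ 1 / (2 * t) := by
      rw [le_div_iff₀ (by positivity)] at htJ ⊢
      linarith
    exact_mod_cast this.trans hj1
  obtain ⟨hlt, h1j⟩ := hJ j hJj
  have h1j' : (1 : ℝ) ≤ j := by exact_mod_cast h1j
  have hlog : 0 < Real.log ((j : ℝ) + 1) := Real.log_pos (by linarith)
  rw [div_lt_iff₀ hlog] at hlt
  have hle := ((hmem j h1j).le_seminorm z).trans hlt.le
  rw [norm_derivative_power hφ, hzt] at hle
  -- Rounding up gives `(j - 1) * t ≤ 1/2`, and Bernoulli applies.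
  have hpow : (1 : ℝ) / 2 ≤ (1 - t) ^ (j - 1) := by
    have hb := one_add_mul_le_pow (by linarith : (-2 : ℝ) ≤ -t) (j - 1)
    rw [← sub_eq_add_neg, Nat.cast_sub h1j, Nat.cast_one] at hb
    have : (j - 1) * t ≤ 1 / (2 * t) * t := by gcongr; linarith
    have h2 : 1 / (2 * t) * t = 1 / 2 := by field_simp
    linarith
  have hlog3 : Real.log ((j : ℝ) + 1) ≤ Real.log (3 / t) := by
    refine Real.log_le_log (by linarith) ?_
    have : 1 / (2 * t) + 2 ≤ 3 / t := by
      rw [div_add' _ _ _ (by positivity), div_le_div_iff₀ (by positivity) ht]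
      nlinarith
    linarith
  set D := ‖derivative (fun z => (φ z : ℂ)) z‖ with hD
  have hμD : 0 ≤ μ z * D := mul_nonneg (μ.pos z).le (norm_nonneg _)
  have hlow : μ z * D * (1 / (2 * t) * (1 / 2)) ≤ μ z * (j * (1 - t) ^ (j - 1) * D) := by
    have : 1 / (2 * t) * (1 / 2) ≤ j * (1 - t) ^ (j - 1) := by gcongr
    calc _ ≤ μ z * D * (j * (1 - t) ^ (j - 1)) := by gcongr
      _ = _ := by ring
  have hfin : μ z * D * (1 / (2 * t) * (1 / 2)) ≤ ε / 4 * Real.log (3 / t) :=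
    hlow.trans (hle.trans (by gcongr))
  calc μ z * D = (μ z * D * (1 / (2 * t) * (1 / 2))) * (4 * t) := by field_simp; norm_num
    _ ≤ ε / 4 * Real.log (3 / t) * (4 * t) := by gcongr
    _ = _ := by ring

theorem power_one (φ : 𝔻 → 𝔻) : power φ 1 = fun z => (φ z : ℂ) := by
  funext z
  simp [power]

theorem isCompactCompOp_of_tendsto {μ : Weight} {φ : 𝔻 → 𝔻}
    (hφ : IsHolomorphic fun z => (φ z : ℂ)) (hmem : ∀ j : ℕ, 1 ≤ j → MemBloch μ (power φ j))
    (hlim : Tendsto (fun j : ℕ => seminorm μ (power φ j) / Real.log ((j : ℝ) + 1))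
      atTop (𝓝 0)) : IsCompactCompOp vlog μ φ := by
  have hrad := fun ε (hε : (0 : ℝ) < ε) => exists_radius_weight_mul_derivative_le hφ hmem hlim hε
  have hφμ : MemBloch μ fun z => (φ z : ℂ) := power_one φ ▸ hmem 1 le_rfl
  set M := seminorm μ fun z => (φ z : ℂ) with hM
  have hM0 : 0 ≤ M := seminorm_nonneg _ _
  have hMle : ∀ z, μ z * ‖derivative (fun z => (φ z : ℂ)) z‖ ≤ M := hφμ.le_seminorm
  have hbd : ∀ f, MemBloch vlog f → MemBloch μ (f ∘ φ) := by
    intro f hf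
    obtain ⟨r, hr1, hr⟩ := hrad 1 one_pos
    have h0 : 0 < 1 - r := sub_pos.2 hr1
    refine ⟨hf.1.comp hφ, max 1 (M / (1 - r)) * seminorm vlog f, ?_⟩
    rintro _ ⟨z, rfl⟩
    -- Where `|φ z| > r` the constant `1` works; elsewhere `v_log(φ z) ≥ 1 - r`.
    have hle : μ z * ‖derivative (fun z => (φ z : ℂ)) z‖ ≤ max 1 (M / (1 - r)) * vlog (φ z) := by
      rcases lt_or_ge r ‖(φ z : ℂ)‖ with hz | hz
      · exact (hr z hz).trans (mul_le_mul_of_nonneg_right (le_max_left _ _) (vlog.pos _).le)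
      · refine (hMle z).trans ?_
        calc M = M / (1 - r) * (1 - r) := by field_simp
          _ ≤ max 1 (M / (1 - r)) * vlog (φ z) := by
            gcongr
            · exact le_max_right _ _
            · linarith [one_sub_norm_le_vlog (φ z)]
    simp only [derivative_comp hf.1 hφ, norm_mul]
    calc μ z * (‖derivative f (φ z)‖ * ‖derivative (fun z => (φ z : ℂ)) z‖)
        = μ z * ‖derivative (fun z => (φ z : ℂ)) z‖ * ‖derivative f (φ z)‖ := by ring
      _ ≤ max 1 (M / (1 - r)) * vlog (φ z) * ‖derivative f (φ z)‖ := by gcongr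
      _ = max 1 (M / (1 - r)) * (vlog (φ z) * ‖derivative f (φ z)‖) := by ring
      _ ≤ _ := by
        gcongr
        exact hf.le_seminorm _
  refine ⟨hbd, ?_⟩
  rw [isCompactOperator_iff_image_closedBall_subset_compact _ one_pos]
  -- The image of the ball is itself compact, since limits of functions in the ball remain there.
  refine ⟨_, ?_, subset_rfl⟩
  rw [← Subtype.range_coe (s := Metric.closedBall (0 : Bloch vlog) 1), ← Set.range_comp]
  set m : Metric.closedBall (0 : Bloch vlog) 1 → Bloch μ := compOp vlog μ φ hbd ∘ Subtype.val
  rw [isCompact_iff_ultrafilter_le_nhds']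
  intro V hV
  rw [← Set.image_univ] at hV
  -- An ultrafilter on the image lifts to the ball, where the normal family argument applies.
  set U := Ultrafilter.ofComapInfPrincipal hV with hU
  obtain ⟨g, hg1, hg⟩ := exists_tendstoLocallyUniformlyOn_extend U
  refine ⟨compOp vlog μ φ hbd g, ⟨⟨g, mem_closedBall_zero_iff.2 hg1⟩, rfl⟩, ?_⟩
  rw [← Ultrafilter.ofComapInfPrincipal_eq_of_map hV]
  change Tendsto m U _
  have hder := hg.deriv (Eventually.of_forall fun i => i.1.2.1) Metric.isOpen_ball
  rw [Metric.tendsto_nhds]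
  intro ε hε
  -- The difference `f` below has norm at most `2`, so `ε / 6` yields `ε / 3`.
  obtain ⟨r, hr1, hr⟩ := hrad (ε / 6) (by positivity)
  have hunif := (tendstoLocallyUniformlyOn_iff_forall_isCompact Metric.isOpen_ball).1 hder
    (Metric.closedBall 0 r) (Metric.closedBall_subset_ball hr1) (isCompact_closedBall 0 r)
  have hpt := hg.tendsto_at (coe_mem_ball (φ 0))
  -- `M + 1` replaces `M`, which may vanish.
  filter_upwards [Metric.tendstoUniformlyOn_iff.1 hunif (ε / (3 * (M + 1))) (by positivity),
    Metric.tendsto_nhds.1 hpt (ε / 3) (by positivity)] with i hi1 hi2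
  have hsub : m i - compOp vlog μ φ hbd g = compOp vlog μ φ hbd (i.1 - g) :=
    (map_sub (compOp vlog μ φ hbd) i.1 g).symm
  rw [dist_eq_norm, hsub, norm_def]
  set f : Bloch vlog := i.1 - g with hf
  have hfval : ∀ z, f.1 z = i.1.1 z - g.1 z := fun z => rfl
  have hfder : ∀ z, derivative f.1 z = derivative i.1.1 z - derivative g.1 z := fun z =>
    map_sub (Bloch.derivativeCLM vlog z) i.1 g
  have hfnorm : ‖f‖ ≤ 2 := by
    have := norm_sub_le i.1 g
    have := mem_closedBall_zero_iff.1 i.2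
    linarith
  have hA : ‖(compOp vlog μ φ hbd f).1 0‖ < ε / 3 := by
    rw [dist_eq_norm, extend_coe, extend_coe] at hi2
    exact hi2
  have hB : seminorm μ (compOp vlog μ φ hbd f).1 ≤ ε / 3 := by
    refine ciSup_le fun z => ?_
    change μ z * ‖derivative (f.1 ∘ φ) z‖ ≤ _
    rw [derivative_comp f.2.1 hφ, norm_mul]
    rcases lt_or_ge r ‖(φ z : ℂ)‖ with hz | hz
    · calc μ z * (‖derivative f.1 (φ z)‖ * ‖derivative (fun z => (φ z : ℂ)) z‖)
          = μ z * ‖derivative (fun z => (φ z : ℂ)) z‖ * ‖derivative f.1 (φ z)‖ := by ring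
        _ ≤ ε / 6 * vlog (φ z) * ‖derivative f.1 (φ z)‖ := 
          mul_le_mul_of_nonneg_right (hr z hz) (norm_nonneg _)
        _ = ε / 6 * (vlog (φ z) * ‖derivative f.1 (φ z)‖) := by ring
        _ ≤ ε / 6 * 2 := by gcongr; exact (f.norm_derivative_le _).trans hfnorm
        _ = ε / 3 := by ring
    · have h1 := (hi1 (φ z) (mem_closedBall_zero_iff.2 hz)).le
      rw [dist_comm, dist_eq_norm] at h1
      have h2 : ‖derivative f.1 (φ z)‖ ≤ ε / (3 * (M + 1)) := by
        rw [hfder]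
        exact h1
      calc μ z * (‖derivative f.1 (φ z)‖ * ‖derivative (fun z => (φ z : ℂ)) z‖)
          = μ z * ‖derivative (fun z => (φ z : ℂ)) z‖ * ‖derivative f.1 (φ z)‖ := by ring
        _ ≤ (M + 1) * (ε / (3 * (M + 1))) := by
          gcongr
          linarith [hMle z]
        _ = ε / 3 := by field_simp
  linarith

end LogBloch

theorem theorem5p5 (μ : LogBloch.Weight) (φ : 𝔻 → 𝔻)
    (hφ : LogBloch.IsHolomorphic fun z => (φ z : ℂ)) :
    (LogBloch.IsCompactCompOp LogBloch.vlog μ φ ↔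
      (∀ j : ℕ, 1 ≤ j → LogBloch.MemBloch μ (LogBloch.power φ j)) ∧
        Tendsto (fun j : ℕ => LogBloch.seminorm μ (LogBloch.power φ j) / Real.log ((j : ℝ) + 1))
          atTop (𝓝 0)) ∧
    (LogBloch.IsCompactCompOp LogBloch.vlog μ φ ↔
      (∀ j : ℕ, 1 ≤ j → LogBloch.MemBloch μ (LogBloch.power φ j)) ∧
        Tendsto (fun j : ℕ => LogBloch.seminorm μ (LogBloch.power φ j) /
            LogBloch.seminorm LogBloch.vlog (LogBloch.monomial j))
          atTop (𝓝 0)) := by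
  have h13 := fun h : LogBloch.IsCompactCompOp LogBloch.vlog μ φ =>
    h.tendsto_seminorm_power_div_seminorm_monomial hφ
  refine ⟨⟨fun h => ⟨fun j _ => h.memBloch_power j,
      LogBloch.tendsto_seminorm_power_div_log (h13 h)⟩, fun h => ?_⟩,
    ⟨fun h => ⟨fun j _ => h.memBloch_power j, h13 h⟩, fun h => ?_⟩⟩
  · exact LogBloch.isCompactCompOp_of_tendsto hφ h.1 h.2
  · exact LogBloch.isCompactCompOp_of_tendsto hφ h.1 (LogBloch.tendsto_seminorm_power_div_log h.2)
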